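/- Let $n$ be a natural number, let $U$ be the set of unitary complex $n\times n$ matrices, regarded as a smooth (real $n^2$-dimensional) submanifold of the real vector space of complex $n\times n$ matrices, and let $B$ be the affine space of real $n\times n$ matrices $(p_{kl})$ such that $\sum_k p_{kl}=1$ for every $l$ and $\sum_l p_{kl}=1$ for every $k$. Let $\mu:U\to B$ be the map that sends a unitary matrix $(u_{kl})$ to the doubly stochastic matrix $(|u_{kl}|^2)$. Then $\mu$ is a submersion at almost every point of $U$: for almost every $u\in U$ with respect to Haar measure on the unitary group $U$, the map $\mu$ is smooth near $u$ and its differential $\mu_{*u}:T_uU\to T_{\mu(u)}B$ is surjective. -/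

import Mathlib

open Set MeasureTheory Topology
open scoped ContDiff

section Submersion

variable {E F : Type*} [NormedAddCommGroup E] [NormedSpace ℝ E]
  [NormedAddCommGroup F] [NormedSpace ℝ F]

/-- The set of velocity vectors `γ'(0)` of smooth curves `γ : (-ε, ε) → E` that lie in `S` and
satisfy `γ(0) = x`.  When `S` is an embedded submanifold of `E`, this is the tangent space of `S`
at `x`. -/
def curveTangentSpace (S : Set E) (x : E) : Set E :=
  {v | ∃ (ε : ℝ) (γ : ℝ → E), 0 < ε ∧ ContDiffOn ℝ ∞ γ (Ioo (-ε) ε) ∧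
    (∀ t ∈ Ioo (-ε) ε, γ t ∈ S) ∧ γ 0 = x ∧ HasDerivAt γ v 0}

/-- A map `f : S → T` between embedded submanifolds of `E` and `F` is a submersion at `x`: near `x`
it is smooth (the restriction of a smooth map `g` defined on a neighbourhood `V` of `x` in `E`), and
its differential at `x` (the restriction of the derivative of `g`, which on the tangent space does
not depend on the choice of `g`) maps the tangent space of `S` at `x` onto the tangent space of `T`
at `f x`. -/
def IsSubmersionAt {σ τ : Type*} [SetLike σ E] [SetLike τ F] {S : σ} {T : τ}
    (f : S → T) (x : S) : Prop :=
  ∃ (g : E → F) (V : Set E), IsOpen V ∧ (x : E) ∈ V ∧ ContDiffOn ℝ ∞ g V ∧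
    (∀ y : S, (y : E) ∈ V → g y = f y) ∧
    SurjOn (fderiv ℝ g x) (curveTangentSpace (S : Set E) x) (curveTangentSpace (T : Set F) (f x))

end Submersion

/-- The affine space `B` of real `n × n` matrices with unit row and column sums. -/
def unitSumMatrices (n : ℕ) : AffineSubspace ℝ (Matrix (Fin n) (Fin n) ℝ) where
  carrier := {p | (∀ l, ∑ k, p k l = 1) ∧ ∀ k, ∑ l, p k l = 1}
  smul_vsub_vadd_mem' := by
    rintro c p q r ⟨hp, hp'⟩ ⟨hq, hq'⟩ ⟨hr, hr'⟩
    constructor <;> intro i <;>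
      simp [Finset.sum_add_distrib, ← Finset.mul_sum, hp, hp', hq, hq', hr, hr']

/-- The map `μ : U → B`, `(u_kl) ↦ (|u_kl|²)`. -/
noncomputable def unitaryToUnitSum (n : ℕ) (u : Matrix.unitaryGroup (Fin n) ℂ) : unitSumMatrices n :=
  ⟨Matrix.of fun k l => ‖(u : Matrix (Fin n) (Fin n) ℂ) k l‖ ^ 2, by
    constructor
    · intro l
      have h := congrFun (congrFun (Matrix.mem_unitaryGroup_iff'.1 u.2) l) l
      simp only [Matrix.mul_apply, Matrix.star_apply, Matrix.one_apply_eq, RCLike.star_def,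
        Complex.conj_mul'] at h
      exact_mod_cast h
    · intro k
      have h := congrFun (congrFun (Matrix.mem_unitaryGroup_iff.1 u.2) k) k
      simp only [Matrix.mul_apply, Matrix.star_apply, Matrix.one_apply_eq, RCLike.star_def,
        Complex.mul_conj'] at h
      exact_mod_cast h⟩

/-
The tangent spaces and derivatives of matrix-valued maps are taken with respect to the entrywise
supremum norm; all norms on these finite-dimensional spaces are equivalent.
-/
attribute [local instance] Matrix.normedAddCommGroup Matrix.normedSpace

/-!
# The squared-modulus map from the unitary group to unit-sum matrices is almost everywhere regular

The vectors tangent to the unitary group at `u` are `A u` with `A` skew-Hermitian, and the vectors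
tangent to the affine space of unit-sum matrices are those with vanishing row and column sums. The
differential sends `A u` to the matrix `2 Re (conj u_kl (A u)_kl)` (`sqNormDeriv`).

It is surjective at `u₀ = 1 + c J`, where `J` is the all-ones matrix and `c = (i - 1) / n`. Indeed, if
the rows of `A` sum to zero, then `A u₀ = A`, and since the diagonal of `A` is imaginary the
differential is `2 Re (conj c A)`. Writing `A = X + i Y` with `X` real antisymmetric and `Y` real
symmetric, this is `(2 / n) (Y - X)`, so every matrix with vanishing row and column sums is attained
by splitting it into its symmetric and antisymmetric parts (`sqNormDeriv_regularPoint_skewLift`).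
Hence `u ↦ det (regularityMap u)`, a polynomial in the real and imaginary parts of the entries, does
not vanish at `u₀`, and the map is a submersion wherever this determinant is nonzero
(`isSubmersionAt_of_det_regularityMap_ne_zero`).

That the zero set `Z` of this function `F` is null is shown without charts. For an analytic curve
`Φ` with `Φ 0 = 1`, invariance and Fubini's theorem give
`ν Z = ∫ |{t ∈ [0, 1] | F (Φ t * g) = 0}| dν(g)`, and the integrand vanishes unless `F` is zero along
the whole curve `Φ t * g`. So for almost every `g` in `Z`, `F` is zero along all of `Φ t * g`
(`ae_forall_eq_zero_along_curve`). Applying this to countably many curves whose endpoints are dense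
in the group gives `F = 0` everywhere, a contradiction, unless `Z` is null
(`ae_ne_zero_of_curves`). The curves used are the Cayley curves `(1 + tK)(1 - tK)⁻¹`. They reach every
unitary matrix without eigenvalue `-1`, hence every unitary matrix up to a phase, and `F` is invariant
under phases (`exists_phase_cayleyCurve_one_eq`, `regularityMap_smul`).
-/

/-! ### Zero sets in topological groups -/

/-- The zero set of a real-analytic function on the line is countable, hence null, unless the
function vanishes identically. -/
theorem AnalyticOnNhd.volume_zeros_eq_zero {φ : ℝ → ℝ} (hφ : AnalyticOnNhd ℝ φ univ)
    {s : ℝ} (hs : φ s ≠ 0) : volume {t | φ t = 0} = 0 := by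
  rcases hφ.eqOn_zero_or_eventually_ne_zero_of_preconnected isPreconnected_univ with h | h
  · exact absurd (h (mem_univ s)) hs
  · have h' : ∀ᵐ t ∂(volume.restrict univ), φ t ≠ 0 :=
      ae_restrict_le_codiscreteWithin MeasurableSet.univ h
    simpa [ae_iff] using h'

section TopologicalGroup

variable {G : Type*} [TopologicalSpace G] [Group G] [IsTopologicalGroup G]
  [SecondCountableTopology G] [MeasurableSpace G] [BorelSpace G]

/-- Averaging the translates of the zero set `Z` of `F` along the curve `Φ` computes `ν Z` as the
integral over `g` of the length of `{t ∈ [0, 1] | F (Φ t * g) = 0}`, which is zero unless `F`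
vanishes on the whole curve through `g`. -/
theorem ae_forall_eq_zero_along_curve (ν : Measure G) [IsFiniteMeasure ν] [ν.IsMulLeftInvariant]
    {F : G → ℝ} (hF : Continuous F) {Φ : ℝ → G} (hΦ : Continuous Φ) (hΦ0 : Φ 0 = 1)
    (han : ∀ g, AnalyticOnNhd ℝ (fun t => F (Φ t * g)) univ) :
    ∀ᵐ g ∂ν, F g = 0 → ∀ t, F (Φ t * g) = 0 := by
  set Z : Set G := {g | F g = 0} with hZ
  set Z' : Set G := {g | ∀ t, F (Φ t * g) = 0} with hZ'
  have hZc : IsClosed Z := isClosed_eq hF continuous_const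
  have hZ'c : IsClosed Z' := by
    simp only [hZ', ofPred_forall]
    exact isClosed_iInter fun t => isClosed_eq (by fun_prop) continuous_const
  have hsub : Z' ⊆ Z := fun g hg => by simpa [hZ, hΦ0] using hg 0
  set E : Set (ℝ × G) := {p | F (Φ p.1 * p.2) = 0} with hE
  have hEc : IsClosed E := isClosed_eq (by fun_prop) continuous_const
  have hEm : MeasurableSet E := hEc.measurableSet
  set lam : Measure ℝ := volume.restrict (Icc 0 1) with hlam
  have hlam1 : lam univ = 1 := by simp [hlam]
  have h1 : (lam.prod ν) E = ν Z := by
    rw [Measure.prod_apply hEm]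
    have : ∀ t, ν (Prod.mk t ⁻¹' E) = ν Z := fun t => measure_preimage_mul ν (Φ t) Z
    simp [this, hlam1]
  have h2 : (lam.prod ν) E ≤ ν Z' := by
    rw [Measure.prod_apply_symm hEm, ← lintegral_indicator_one hZ'c.measurableSet]
    refine lintegral_mono fun g => ?_
    by_cases hg : g ∈ Z'
    · rw [indicator_of_mem hg]
      calc _ ≤ lam univ := measure_mono (subset_univ _)
        _ = _ := by simp [hlam1]
    · obtain ⟨s, hs⟩ : ∃ s, F (Φ s * g) ≠ 0 := by simpa [hZ'] using hg
      have : lam {t | F (Φ t * g) = 0} = 0 :=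
        Measure.absolutelyContinuous_of_le Measure.restrict_le_self
          ((han g).volume_zeros_eq_zero hs)
      exact this.le.trans zero_le
  have h3 : ν (Z \ Z') = 0 := by
    rw [measure_sdiff hsub hZ'c.measurableSet.nullMeasurableSet (measure_ne_top _ _)]
    exact tsub_eq_zero_of_le (h1 ▸ h2)
  filter_upwards [measure_eq_zero_iff_ae_notMem.1 h3] with g hg h0
  by_contra h
  exact hg ⟨h0, h⟩

/-- If, up to symmetries of the zero set of `F`, every element of the group is reached from `1` by a
curve along whose translates `F` is analytic, then `F` is almost everywhere nonzero unless it
vanishes identically: at almost every zero of `F`, the function would vanish at a dense set of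
translates. -/
theorem ae_ne_zero_of_curves (ν : Measure G) [IsFiniteMeasure ν] [ν.IsMulLeftInvariant]
    {F : G → ℝ} (hF : Continuous F) {g₀ : G} (hg₀ : F g₀ ≠ 0)
    (hcurve : ∀ h : G, ∃ Φ : ℝ → G, Continuous Φ ∧ Φ 0 = 1 ∧
      (∀ g, AnalyticOnNhd ℝ (fun t => F (Φ t * g)) univ) ∧ ∀ g, F (Φ 1 * g) = F (h * g)) :
    ∀ᵐ g ∂ν, F g ≠ 0 := by
  choose Φ hc h0 han h1 using hcurve
  have key : ∀ᵐ g ∂ν, ∀ i : ℕ, F g = 0 → ∀ t, F (Φ (TopologicalSpace.denseSeq G i) t * g) = 0 :=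
    ae_all_iff.2 fun i => ae_forall_eq_zero_along_curve ν hF (hc _) (h0 _) (han _)
  filter_upwards [key] with g hg hzero
  have hcl : IsClosed {h : G | F (h * g) = 0} := isClosed_eq (by fun_prop) continuous_const
  have hdense : range (TopologicalSpace.denseSeq G) ⊆ {h : G | F (h * g) = 0} := by
    rintro _ ⟨i, rfl⟩
    rw [mem_ofPred_eq, ← h1]
    exact hg i hzero 1
  have huniv : g₀ * g⁻¹ ∈ {h : G | F (h * g) = 0} :=
    hcl.closure_subset_iff.2 hdense (TopologicalSpace.denseRange_denseSeq G _)
  exact hg₀ (by simpa using huniv)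

end TopologicalGroup

/-! ### Analytic families of matrices -/

section AnalyticMatrix

variable {𝕜 R E ι : Type*} [NontriviallyNormedField 𝕜] [NormedAddCommGroup E] [NormedSpace 𝕜 E]
  [NormedField R] [NormedAlgebra 𝕜 R] [Fintype ι] [DecidableEq ι]

theorem analyticAt_matrix_det {M : E → Matrix ι ι R} {x : E}
    (hM : ∀ i j, AnalyticAt 𝕜 (fun t => M t i j) x) : AnalyticAt 𝕜 (fun t => (M t).det) x := by
  simp only [Matrix.det_apply]
  refine Finset.analyticAt_fun_sum _ fun σ _ => ?_
  simp only [Units.smul_def, zsmul_eq_mul]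
  exact analyticAt_const.mul (Finset.analyticAt_fun_prod _ fun i _ => hM _ _)

omit [DecidableEq ι] in
theorem analyticAt_matrix_mul {M N : E → Matrix ι ι R} {x : E}
    (hM : ∀ i j, AnalyticAt 𝕜 (fun t => M t i j) x) (hN : ∀ i j, AnalyticAt 𝕜 (fun t => N t i j) x)
    (i j : ι) : AnalyticAt 𝕜 (fun t => (M t * N t) i j) x := by
  simp only [Matrix.mul_apply]
  exact Finset.analyticAt_fun_sum _ fun k _ => (hM i k).mul (hN k j)

theorem analyticAt_matrix_inv {M : E → Matrix ι ι R} {x : E}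
    (hM : ∀ i j, AnalyticAt 𝕜 (fun t => M t i j) x) (hx : (M x).det ≠ 0)
    (i j : ι) : AnalyticAt 𝕜 (fun t => (M t)⁻¹ i j) x := by
  simp only [Matrix.inv_def, Matrix.smul_apply, Ring.inverse_eq_inv', smul_eq_mul,
    Matrix.adjugate_apply]
  refine ((analyticAt_matrix_det hM).inv hx).mul (analyticAt_matrix_det fun k l => ?_)
  by_cases hk : k = j
  · simpa [hk] using analyticAt_const
  · simpa [Matrix.updateRow_ne hk] using hM k l

end AnalyticMatrix

/-! ### Cayley curves in the unitary group -/

section Cayley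

variable {ι : Type*} [Fintype ι] [DecidableEq ι]

open Matrix

/-- The Cayley curve `t ↦ (1 + tK)(1 - tK)⁻¹`, which for skew-Hermitian `K` lies in the unitary
group. -/
noncomputable def cayleyCurve (K : Matrix ι ι ℂ) (t : ℝ) : Matrix ι ι ℂ :=
  (1 + (t : ℂ) • K) * (1 - (t : ℂ) • K)⁻¹

open scoped ComplexOrder in
theorem det_one_sub_smul_ne_zero {K : Matrix ι ι ℂ} (hK : Kᴴ = -K) (t : ℝ) :
    (1 - (t : ℂ) • K).det ≠ 0 := by
  have h : (1 - (t : ℂ) • K)ᴴ * (1 - (t : ℂ) • K) = 1 + ((t : ℂ) • K)ᴴ * ((t : ℂ) • K) := by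
    simp [hK, conjTranspose_smul, mul_sub, add_mul]
    abel
  have hpos := (PosDef.one (n := ι) (R := ℂ)).add_posSemidef
    (posSemidef_conjTranspose_mul_self ((t : ℂ) • K))
  have hdet := hpos.det_pos.ne'
  rw [← h, det_mul] at hdet
  exact right_ne_zero_of_mul hdet

theorem cayleyCurve_zero (K : Matrix ι ι ℂ) : cayleyCurve K 0 = 1 := by
  simp [cayleyCurve]

theorem cayleyCurve_mem_unitaryGroup {K : Matrix ι ι ℂ} (hK : Kᴴ = -K) (t : ℝ) :
    cayleyCurve K t ∈ unitaryGroup ι ℂ := by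
  have h1 := det_one_sub_smul_ne_zero hK t
  have h2 : (1 + (t : ℂ) • K).det ≠ 0 := by
    simpa using det_one_sub_smul_ne_zero hK (-t)
  have hc : (1 + (t : ℂ) • K) * (1 - (t : ℂ) • K) = (1 - (t : ℂ) • K) * (1 + (t : ℂ) • K) := by
    simp only [mul_sub, add_mul, mul_add, sub_mul, one_mul, mul_one]
    abel
  have hs : star (cayleyCurve K t) = (1 + (t : ℂ) • K)⁻¹ * (1 - (t : ℂ) • K) := by
    simp [cayleyCurve, star_eq_conjTranspose, conjTranspose_nonsing_inv, hK, sub_eq_add_neg]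
  rw [mem_unitaryGroup_iff', hs, cayleyCurve, mul_assoc, ← mul_assoc (1 - _), ← hc, mul_assoc,
    mul_nonsing_inv _ h1.isUnit, mul_one, nonsing_inv_mul _ h2.isUnit]

theorem analyticAt_cayleyCurve {K : Matrix ι ι ℂ} (hK : Kᴴ = -K) (t : ℝ) (i j : ι) :
    AnalyticAt ℝ (fun t => cayleyCurve K t i j) t := by
  have hof : AnalyticAt ℝ (fun t : ℝ => (t : ℂ)) t := Complex.ofRealCLM.analyticAt t
  refine analyticAt_matrix_mul (M := fun t : ℝ => 1 + (t : ℂ) • K)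
    (N := fun t : ℝ => (1 - (t : ℂ) • K)⁻¹) (fun k l => ?_)
    (analyticAt_matrix_inv (fun k l => ?_) (det_one_sub_smul_ne_zero hK t)) i j
  · simpa using analyticAt_const.fun_add (hof.fun_mul analyticAt_const)
  · simpa using analyticAt_const.fun_sub (hof.fun_mul analyticAt_const)

theorem hasDerivAt_cayleyCurve_zero {K : Matrix ι ι ℂ} (hK : Kᴴ = -K) (i j : ι) :
    HasDerivAt (fun t => cayleyCurve K t i j) (2 * K i j) 0 := by
  -- The curve is `1 + t • (2K(1 - tK)⁻¹)`, so its derivative at `0` is the second factor there.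
  have hG : ∀ t : ℝ, cayleyCurve K t = 1 + (t : ℂ) • ((2 : ℂ) • K * (1 - (t : ℂ) • K)⁻¹) := by
    intro t
    have h1 := det_one_sub_smul_ne_zero hK t
    rw [cayleyCurve, ← sub_eq_iff_eq_add']
    calc (1 + (t : ℂ) • K) * (1 - (t : ℂ) • K)⁻¹ - 1
        = (1 + (t : ℂ) • K) * (1 - (t : ℂ) • K)⁻¹ - (1 - (t : ℂ) • K) * (1 - (t : ℂ) • K)⁻¹ := by
          rw [mul_nonsing_inv _ h1.isUnit]
      _ = (t : ℂ) • ((2 : ℂ) • K * (1 - (t : ℂ) • K)⁻¹) := by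
          rw [← sub_mul, ← smul_mul_assoc]
          congr 1
          module
  have hinv : AnalyticAt ℝ (fun t : ℝ => ((2 : ℂ) • K * (1 - (t : ℂ) • K)⁻¹) i j) 0 := by
    refine analyticAt_matrix_mul (M := fun _ : ℝ => (2 : ℂ) • K)
      (N := fun t : ℝ => (1 - (t : ℂ) • K)⁻¹) (fun k l => analyticAt_const)
      (analyticAt_matrix_inv (fun k l => ?_) (det_one_sub_smul_ne_zero hK 0)) i j
    have hof : AnalyticAt ℝ (fun t : ℝ => (t : ℂ)) 0 := Complex.ofRealCLM.analyticAt 0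
    simpa using analyticAt_const.fun_sub (hof.fun_mul analyticAt_const)
  have hd := (((Complex.ofRealCLM.hasDerivAt (x := (0 : ℝ))).mul
    hinv.differentiableAt.hasDerivAt).const_add ((1 : Matrix ι ι ℂ) i j))
  refine (hd.congr_deriv ?_).congr_of_eventuallyEq (Filter.Eventually.of_forall fun t => ?_)
  · simp
  · simp [hG t]

theorem infinite_unit_complex : {z : ℂ | ‖z‖ = 1}.Infinite := by
  refine infinite_of_injOn_mapsTo (s := Ioo (0 : ℝ) 1) (f := fun t : ℝ => Complex.exp (t * Complex.I))
    ?_ (fun t _ => by simp [Complex.norm_exp_ofReal_mul_I]) (Ioo_infinite one_pos)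
  intro s hs t ht h
  have h' := congrArg Complex.arg h
  have hpi := Real.pi_gt_three
  simp only [Complex.arg_exp_mul_I] at h'
  rwa [(toIocMod_eq_self _).2 ⟨by linarith [hs.1], by linarith [hs.2]⟩,
    (toIocMod_eq_self _).2 ⟨by linarith [ht.1], by linarith [ht.2]⟩] at h'

/-- Every unitary matrix without eigenvalue `-1` is the endpoint of a Cayley curve. -/
theorem exists_cayleyCurve_one_eq {w : Matrix ι ι ℂ} (hw : w ∈ unitaryGroup ι ℂ)
    (hdet : (1 + w).det ≠ 0) : ∃ K : Matrix ι ι ℂ, Kᴴ = -K ∧ cayleyCurve K 1 = w := by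
  have hu := hdet.isUnit
  -- The inverse Cayley transform of `w`; it is skew-Hermitian because `(1 + w) Kᴴ = -(1 + w) K`.
  set K := (w - 1) * (1 + w)⁻¹ with hKdef
  have hr : K * (1 + w) = w - 1 := by rw [hKdef, mul_assoc, nonsing_inv_mul _ hu, mul_one]
  have hl : (1 + w) * K = w - 1 := by
    rw [hKdef, ← mul_assoc, show (1 + w) * (w - 1) = (w - 1) * (1 + w) by noncomm_ring, mul_assoc,
      mul_nonsing_inv _ hu, mul_one]
  have hww : w * wᴴ = 1 := mem_unitaryGroup_iff.1 hw
  have hstar : (1 + w) * Kᴴ = 1 - w := by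
    have h : (1 + wᴴ) * Kᴴ = wᴴ - 1 := by simpa using congrArg conjTranspose hr
    calc (1 + w) * Kᴴ = w * ((1 + wᴴ) * Kᴴ) := by
          rw [← mul_assoc, mul_add, hww, mul_one, add_comm]
      _ = 1 - w := by rw [h, mul_sub, hww, mul_one]
  have hK : Kᴴ = -K := by
    have h : (1 + w) * Kᴴ = (1 + w) * (-K) := by rw [hstar, mul_neg, hl, neg_sub]
    simpa [nonsing_inv_mul_cancel_left _ _ hu] using congrArg ((1 + w)⁻¹ * ·) h
  refine ⟨K, hK, ?_⟩
  have h1 : (1 - K).det ≠ 0 := by simpa using det_one_sub_smul_ne_zero hK 1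
  have h : 1 + K = w * (1 - K) := by
    rw [mul_sub, mul_one, ← sub_eq_zero]
    calc 1 + K - (w - w * K) = (1 + w) * K - (w - 1) := by noncomm_ring
      _ = 0 := by rw [hl, sub_self]
  simp only [cayleyCurve, Complex.ofReal_one, one_smul]
  rw [h, mul_assoc, mul_nonsing_inv _ h1.isUnit, mul_one]

/-- After multiplication by a suitable phase, every unitary matrix is the endpoint of a Cayley
curve: the phase only has to avoid finitely many eigenvalues. -/
theorem exists_phase_cayleyCurve_one_eq {h : Matrix ι ι ℂ} (hh : h ∈ unitaryGroup ι ℂ) :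
    ∃ (z : ℂ) (K : Matrix ι ι ℂ), ‖z‖ = 1 ∧ Kᴴ = -K ∧ cayleyCurve K 1 = z • h := by
  obtain ⟨z, hz, hroot⟩ : ∃ z ∈ {z : ℂ | ‖z‖ = 1}, z ∉ ((-h).charpoly.roots.toFinset : Set ℂ) :=
    (infinite_unit_complex.sdiff (Finset.finite_toSet _)).nonempty
  have hz1 : ‖z‖ = 1 := hz
  have hz0 : z ≠ 0 := by rintro rfl; simp at hz1
  have heval : (scalar ι z + h).det ≠ 0 := by
    simpa [(charpoly_monic _).ne_zero, eval_charpoly] using hroot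
  have hfac : scalar ι z + h = z • (1 + z⁻¹ • h) := by
    rw [smul_add, smul_smul, mul_inv_cancel₀ hz0, one_smul, smul_one_eq_diagonal, scalar_apply]
  rw [hfac, det_smul] at heval
  have hmem : z⁻¹ • h ∈ unitaryGroup ι ℂ := by
    have hzz : z⁻¹ * star z⁻¹ = 1 := by
      rw [RCLike.star_def, Complex.mul_conj']; simp [hz1]
    rw [mem_unitaryGroup_iff, star_smul, smul_mul_smul_comm, hzz, one_smul,
      mem_unitaryGroup_iff.1 hh]
  obtain ⟨K, hK, hK1⟩ := exists_cayleyCurve_one_eq hmem (right_ne_zero_of_mul heval)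
  exact ⟨z⁻¹, K, by simp [hz1], hK, hK1⟩

end Cayley

/-! ### The differential of the squared-modulus map -/

section Differential

open Matrix

variable {n : ℕ}

/-- The value `(2 Re (conj M_kl (A M)_kl))` of the differential of `M ↦ (|M_kl|²)` at `M` on the
vector `A M`; for unitary `M` and skew-Hermitian `A`, this vector is tangent to the unitary group. -/
noncomputable def sqNormDeriv (M : Matrix (Fin n) (Fin n) ℂ) :
    Matrix (Fin n) (Fin n) ℂ →ₗ[ℝ] Matrix (Fin n) (Fin n) ℝ where
  toFun A := of fun k l => 2 * (star (M k l) * (A * M) k l).re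
  map_add' A B := by
    ext k l
    simp [add_mul, mul_add]
  map_smul' c A := by
    ext k l
    simp
    ring

theorem sqNormDeriv_apply (M A : Matrix (Fin n) (Fin n) ℂ) (k l : Fin n) :
    sqNormDeriv M A k l = 2 * (star (M k l) * (A * M) k l).re := rfl

/-- The projection `v_kl ↦ v_kl - (row mean) - (column mean) + (total mean)` onto the matrices with
vanishing row and column sums. -/
noncomputable def doubleCentering :
    Matrix (Fin n) (Fin n) ℝ →ₗ[ℝ] Matrix (Fin n) (Fin n) ℝ where
  toFun v := of fun k l => v k l - (∑ j, v k j) / n - (∑ i, v i l) / n + (∑ i, ∑ j, v i j) / n ^ 2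
  map_add' v w := by
    ext k l
    simp only [Matrix.add_apply, of_apply, Finset.sum_add_distrib]
    ring
  map_smul' c v := by
    ext k l
    simp only [Matrix.smul_apply, of_apply, RingHom.id_apply, smul_eq_mul, ← Finset.mul_sum]
    ring

theorem doubleCentering_apply (v : Matrix (Fin n) (Fin n) ℝ) (k l : Fin n) :
    doubleCentering v k l =
      v k l - (∑ j, v k j) / n - (∑ i, v i l) / n + (∑ i, ∑ j, v i j) / n ^ 2 := rfl

/-- The skew-Hermitian matrix `(n / 4) ((vᵀ - v) + i (v + vᵀ))`, which is mapped to `v` by the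
differential at `1 + ((i - 1) / n) J`, for `J` the all-ones matrix. -/
noncomputable def skewLift :
    Matrix (Fin n) (Fin n) ℝ →ₗ[ℝ] Matrix (Fin n) (Fin n) ℂ where
  toFun v := of fun k l => ⟨n / 4 * (v l k - v k l), n / 4 * (v k l + v l k)⟩
  map_add' v w := by
    ext k l
    apply Complex.ext <;> simp <;> ring
  map_smul' c v := by
    ext k l
    apply Complex.ext <;> simp <;> ring

theorem doubleCentering_row_sum (v : Matrix (Fin n) (Fin n) ℝ) (k : Fin n) :
    ∑ l, doubleCentering v k l = 0 := by
  have hn : (n : ℝ) ≠ 0 := Nat.cast_ne_zero.2 (Fin.pos k).ne'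
  have hc : ∑ l, ∑ i, v i l = ∑ i, ∑ j, v i j := Finset.sum_comm
  simp only [doubleCentering_apply, Finset.sum_add_distrib,
    Finset.sum_sub_distrib, ← Finset.sum_div, hc, Finset.sum_const, Finset.card_univ,
    Fintype.card_fin, nsmul_eq_mul]
  field_simp
  ring

theorem doubleCentering_col_sum (v : Matrix (Fin n) (Fin n) ℝ) (l : Fin n) :
    ∑ k, doubleCentering v k l = 0 := by
  have hn : (n : ℝ) ≠ 0 := Nat.cast_ne_zero.2 (Fin.pos l).ne'
  simp only [doubleCentering_apply, Finset.sum_add_distrib,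
    Finset.sum_sub_distrib, ← Finset.sum_div, Finset.sum_const, Finset.card_univ,
    Fintype.card_fin, nsmul_eq_mul]
  field_simp
  ring

theorem doubleCentering_eq_self {v : Matrix (Fin n) (Fin n) ℝ} (hr : ∀ k, ∑ l, v k l = 0)
    (hc : ∀ l, ∑ k, v k l = 0) : doubleCentering v = v := by
  ext k l
  have h : ∑ i, ∑ j, v i j = 0 := Finset.sum_eq_zero fun i _ => hr i
  rw [doubleCentering_apply, hr, hc, h]
  simp

theorem conjTranspose_skewLift (v : Matrix (Fin n) (Fin n) ℝ) :
    (skewLift v)ᴴ = -skewLift v := by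
  ext k l
  apply Complex.ext <;> simp [skewLift, -mul_eq_mul_left_iff] <;> ring

theorem skewLift_row_sum {v : Matrix (Fin n) (Fin n) ℝ} (hr : ∀ k, ∑ l, v k l = 0)
    (hc : ∀ l, ∑ k, v k l = 0) (k : Fin n) : ∑ l, skewLift v k l = 0 := by
  apply Complex.ext <;>
    simp [skewLift, ← Finset.mul_sum, Finset.sum_add_distrib, Finset.sum_sub_distrib, hr, hc]

theorem re_apply_self_of_skew {A : Matrix (Fin n) (Fin n) ℂ} (hA : Aᴴ = -A) (k : Fin n) :
    (A k k).re = 0 := by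
  have h := congrArg Complex.re (congrFun (congrFun hA k) k)
  simp at h
  linarith

theorem sqNormDeriv_row_sum {M A : Matrix (Fin n) (Fin n) ℂ} (hM : M ∈ unitaryGroup (Fin n) ℂ)
    (hA : Aᴴ = -A) (k : Fin n) : ∑ l, sqNormDeriv M A k l = 0 := by
  have h : ∑ l, star (M k l) * (A * M) k l = A k k := by
    calc ∑ l, star (M k l) * (A * M) k l = (A * M * star M) k k := by
          rw [mul_apply (M := A * M)]
          exact Finset.sum_congr rfl fun l _ => mul_comm _ _
      _ = A k k := by rw [mul_assoc, mem_unitaryGroup_iff.1 hM, mul_one]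
  simp only [sqNormDeriv_apply]
  rw [← Finset.mul_sum, ← Complex.re_sum, h, re_apply_self_of_skew hA, mul_zero]

theorem sqNormDeriv_col_sum {M A : Matrix (Fin n) (Fin n) ℂ} (hA : Aᴴ = -A) (l : Fin n) :
    ∑ k, sqNormDeriv M A k l = 0 := by
  have h : ∑ k, star (M k l) * (A * M) k l = (Mᴴ * (A * M)) l l := by
    rw [mul_apply (M := Mᴴ)]
    rfl
  have hskew : (Mᴴ * (A * M))ᴴ = -(Mᴴ * (A * M)) := by
    simp [conjTranspose_mul, hA, mul_assoc]
  simp only [sqNormDeriv_apply]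
  rw [← Finset.mul_sum, ← Complex.re_sum, h, re_apply_self_of_skew hskew, mul_zero]

/-! ### A regular point -/

/-- The unitary matrix `1 + ((i - 1) / n) J`, with `J` the all-ones matrix. -/
noncomputable def regularPoint (n : ℕ) : Matrix (Fin n) (Fin n) ℂ :=
  1 + of fun _ _ => (Complex.I - 1) / n

theorem regularPoint_mem_unitaryGroup (n : ℕ) : regularPoint n ∈ unitaryGroup (Fin n) ℂ := by
  rw [mem_unitaryGroup_iff, star_eq_conjTranspose]
  have h : (regularPoint n)ᴴ = 1 + of fun _ _ => (-Complex.I - 1) / (n : ℂ) := by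
    rw [regularPoint, conjTranspose_add, conjTranspose_one]
    congr 1
    ext k l
    simp
  rw [h, regularPoint, add_mul, mul_add, mul_add, one_mul, mul_one, add_assoc, add_eq_left]
  ext k l
  have hn : (n : ℂ) ≠ 0 := Nat.cast_ne_zero.2 (Fin.pos k).ne'
  simp [mul_apply]
  field_simp
  linear_combination -Complex.I_sq

theorem sqNormDeriv_regularPoint_skewLift {v : Matrix (Fin n) (Fin n) ℝ}
    (hr : ∀ k, ∑ l, v k l = 0) (hc : ∀ l, ∑ k, v k l = 0) :
    sqNormDeriv (regularPoint n) (skewLift v) = v := by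
  have hmul : skewLift v * regularPoint n = skewLift v := by
    rw [regularPoint, mul_add, mul_one, add_eq_left]
    ext k l
    simp [mul_apply, ← Finset.sum_mul, skewLift_row_sum hr hc]
  ext k l
  have hn : (n : ℝ) ≠ 0 := Nat.cast_ne_zero.2 (Fin.pos k).ne'
  simp only [sqNormDeriv_apply, hmul]
  -- Diagonal entries of the lift are purely imaginary, so the identity part contributes nothing.
  have hdiag : (star ((1 : Matrix (Fin n) (Fin n) ℂ) k l) * skewLift v k l).re = 0 := by
    by_cases h : k = l
    · subst h
      simpa using re_apply_self_of_skew (conjTranspose_skewLift v) k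
    · simp [one_apply_ne h]
  have hconst : (star ((Complex.I - 1) / (n : ℂ)) * skewLift v k l).re = v k l / 2 := by
    have : star ((Complex.I - 1) / (n : ℂ)) = ⟨-1 / n, -1 / n⟩ := by
      apply Complex.ext <;> simp [Complex.div_natCast_re, Complex.div_natCast_im]
    rw [this]
    simp [skewLift]
    field_simp
    ring
  rw [regularPoint, Matrix.add_apply, of_apply, star_add, add_mul, Complex.add_re, hdiag, hconst]
  ring

/-! ### An analytic function detecting regular points -/

/-- The endomorphism of the space of real matrices which is the differential at `M`, composed with
`skewLift`, on matrices with vanishing row and column sums, and the identity on the kernel of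
`doubleCentering`. -/
noncomputable def regularityMap (M : Matrix (Fin n) (Fin n) ℂ) :
    Matrix (Fin n) (Fin n) ℝ →ₗ[ℝ] Matrix (Fin n) (Fin n) ℝ :=
  sqNormDeriv M ∘ₗ skewLift ∘ₗ doubleCentering + (LinearMap.id - doubleCentering)

theorem regularityMap_regularPoint (n : ℕ) : regularityMap (regularPoint n) = LinearMap.id := by
  refine LinearMap.ext fun v => ?_
  simp [regularityMap, sqNormDeriv_regularPoint_skewLift (doubleCentering_row_sum v)
    (doubleCentering_col_sum v)]

/-- If the endomorphism `regularityMap M` is invertible, then the differential at the unitary matrix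
`M` maps the tangent space of the unitary group onto the matrices with vanishing row and column
sums. -/
theorem exists_sqNormDeriv_eq {M : Matrix (Fin n) (Fin n) ℂ} (hM : M ∈ unitaryGroup (Fin n) ℂ)
    (hdet : LinearMap.det (regularityMap M) ≠ 0) {v : Matrix (Fin n) (Fin n) ℝ}
    (hr : ∀ k, ∑ l, v k l = 0) (hc : ∀ l, ∑ k, v k l = 0) :
    ∃ A, Aᴴ = -A ∧ sqNormDeriv M A = v := by
  obtain ⟨w, hw⟩ := ((LinearMap.isUnit_iff_isUnit_det _).2 hdet.isUnit |>
    (Module.End.isUnit_iff _).1).2 v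
  have hskew := conjTranspose_skewLift (doubleCentering w)
  refine ⟨skewLift (doubleCentering w), hskew, ?_⟩
  -- Applying `doubleCentering` removes the component of `w` on which the map is the identity.
  have h := congrArg doubleCentering hw
  simp only [regularityMap, LinearMap.add_apply, LinearMap.sub_apply, LinearMap.comp_apply,
    LinearMap.id_apply, map_add, map_sub] at h
  rwa [doubleCentering_eq_self hr hc, doubleCentering_eq_self (sqNormDeriv_row_sum hM hskew)
    (sqNormDeriv_col_sum hskew), doubleCentering_eq_self (doubleCentering_row_sum w)
    (doubleCentering_col_sum w), sub_self, add_zero] at h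

theorem regularityMap_smul {z : ℂ} (hz : ‖z‖ = 1) (M : Matrix (Fin n) (Fin n) ℂ) :
    regularityMap (z • M) = regularityMap M := by
  have h : sqNormDeriv (z • M) = sqNormDeriv M := by
    refine LinearMap.ext fun A => ?_
    ext k l
    have hzz : star z * z = 1 := by
      rw [RCLike.star_def, Complex.conj_mul']; simp [hz]
    simp only [sqNormDeriv_apply, Matrix.smul_apply, smul_eq_mul, Matrix.mul_smul, star_mul']
    rw [mul_mul_mul_comm, hzz, one_mul]
  rw [regularityMap, h, regularityMap]

theorem det_regularityMap_eq (M : Matrix (Fin n) (Fin n) ℂ) :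
    LinearMap.det (regularityMap M) = Matrix.det (of fun p q : Fin n × Fin n =>
      regularityMap M (single q.1 q.2 1) p.1 p.2) := by
  rw [← LinearMap.det_toMatrix (stdBasis ℝ (Fin n) (Fin n))]
  congr 1
  ext p q
  rw [LinearMap.toMatrix_apply, ← Prod.mk.eta (p := q), stdBasis_eq_single]
  simp [stdBasis]

theorem continuous_sqNormDeriv_apply (A : Matrix (Fin n) (Fin n) ℂ) (k l : Fin n) :
    Continuous fun M : Matrix (Fin n) (Fin n) ℂ => sqNormDeriv M A k l := by
  have hM : Continuous fun M : Matrix (Fin n) (Fin n) ℂ => M k l := continuous_id.matrix_elem k l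
  have hAM : Continuous fun M : Matrix (Fin n) (Fin n) ℂ => (A * M) k l :=
    (continuous_const.matrix_mul continuous_id).matrix_elem k l
  exact continuous_const.mul (Complex.continuous_re.comp (hM.star.mul hAM))

theorem analyticAt_sqNormDeriv_apply {M : ℝ → Matrix (Fin n) (Fin n) ℂ} {t : ℝ}
    (hM : ∀ i j, AnalyticAt ℝ (fun t => M t i j) t) (A : Matrix (Fin n) (Fin n) ℂ) (k l : Fin n) :
    AnalyticAt ℝ (fun t => sqNormDeriv (M t) A k l) t := by
  have hstar : AnalyticAt ℝ (fun t => star (M t k l)) t :=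
    AnalyticAt.fun_comp (g := Complex.conjCLE) (Complex.conjCLE.toContinuousLinearMap.analyticAt _)
      (hM k l)
  have hAM : AnalyticAt ℝ (fun t => (A * M t) k l) t :=
    analyticAt_matrix_mul (M := fun _ => A) (fun _ _ => analyticAt_const) hM k l
  exact analyticAt_const.fun_mul
    (AnalyticAt.fun_comp (g := Complex.reCLM) (Complex.reCLM.analyticAt _) (hstar.fun_mul hAM))

theorem continuous_det_regularityMap :
    Continuous fun M : Matrix (Fin n) (Fin n) ℂ => LinearMap.det (regularityMap M) := by
  simp only [det_regularityMap_eq]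
  refine Continuous.matrix_det (continuous_matrix fun p q => ?_)
  exact (continuous_sqNormDeriv_apply _ _ _).add continuous_const

theorem analyticAt_det_regularityMap {M : ℝ → Matrix (Fin n) (Fin n) ℂ} {t : ℝ}
    (hM : ∀ i j, AnalyticAt ℝ (fun t => M t i j) t) :
    AnalyticAt ℝ (fun t => LinearMap.det (regularityMap (M t))) t := by
  simp only [det_regularityMap_eq]
  refine analyticAt_matrix_det fun p q => ?_
  exact (analyticAt_sqNormDeriv_apply hM _ _ _).fun_add analyticAt_const

end Differential

/-! ### Tangent spaces and the submersion property -/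

theorem sums_eq_zero_of_mem_curveTangentSpace {n : ℕ} {p v : Matrix (Fin n) (Fin n) ℝ}
    (hv : v ∈ curveTangentSpace (unitSumMatrices n : Set (Matrix (Fin n) (Fin n) ℝ)) p) :
    (∀ k, ∑ l, v k l = 0) ∧ ∀ l, ∑ k, v k l = 0 := by
  obtain ⟨ε, γ, hε, -, hγ, -, hd⟩ := hv
  have hd' : ∀ k l, HasDerivAt (fun t => γ t k l) (v k l) 0 := fun k l =>
    hasDerivAt_pi.1 (hasDerivAt_pi.1 hd k) l
  have hnhds : Ioo (-ε) ε ∈ 𝓝 (0 : ℝ) := Ioo_mem_nhds (by linarith) hε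
  constructor
  · intro k
    refine (HasDerivAt.fun_sum fun l (_ : l ∈ Finset.univ) => hd' k l).unique
      ((hasDerivAt_const (0 : ℝ) (1 : ℝ)).congr_of_eventuallyEq ?_)
    filter_upwards [hnhds] with t ht using (hγ t ht).2 k
  · intro l
    refine (HasDerivAt.fun_sum fun k (_ : k ∈ Finset.univ) => hd' k l).unique
      ((hasDerivAt_const (0 : ℝ) (1 : ℝ)).congr_of_eventuallyEq ?_)
    filter_upwards [hnhds] with t ht using (hγ t ht).1 l

open Matrix in
/-- The velocity vector `A u` is realized by the Cayley curve of `A / 2` through `u`. -/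
theorem mul_mem_curveTangentSpace_unitaryGroup {n : ℕ} {A u : Matrix (Fin n) (Fin n) ℂ}
    (hA : Aᴴ = -A) (hu : u ∈ unitaryGroup (Fin n) ℂ) :
    A * u ∈ curveTangentSpace (unitaryGroup (Fin n) ℂ : Set (Matrix (Fin n) (Fin n) ℂ)) u := by
  set K : Matrix (Fin n) (Fin n) ℂ := (2⁻¹ : ℂ) • A with hKdef
  have hK : Kᴴ = -K := by simp [hKdef, conjTranspose_smul, hA]
  refine ⟨1, fun t => cayleyCurve K t * u, one_pos, ?_, fun t _ =>
    mul_mem (cayleyCurve_mem_unitaryGroup hK t) hu, by simp [cayleyCurve_zero], ?_⟩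
  · refine contDiffOn_pi.2 fun i => contDiffOn_pi.2 fun j t _ => ?_
    exact (analyticAt_matrix_mul (analyticAt_cayleyCurve hK t) (N := fun _ => u)
      (fun _ _ => analyticAt_const) i j).contDiffAt.contDiffWithinAt
  · refine hasDerivAt_pi.2 fun i => hasDerivAt_pi.2 fun j => ?_
    change HasDerivAt (fun t => (cayleyCurve K t * u) i j) ((A * u) i j) 0
    simp only [mul_apply]
    refine HasDerivAt.fun_sum fun k _ => ?_
    have h := (hasDerivAt_cayleyCurve_zero hK i k).mul_const (u k j)
    rwa [show 2 * K i k * u k j = A i k * u k j by simp [hKdef]] at h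

/-- The map `M ↦ (|M_kl|²)` on all complex matrices, which extends `unitaryToUnitSum`. -/
noncomputable def sqNormMatrix {n : ℕ} (M : Matrix (Fin n) (Fin n) ℂ) : Matrix (Fin n) (Fin n) ℝ :=
  Matrix.of fun k l => ‖M k l‖ ^ 2

theorem contDiff_sqNormMatrix {n : ℕ} :
    ContDiff ℝ ∞ (sqNormMatrix : Matrix (Fin n) (Fin n) ℂ → Matrix (Fin n) (Fin n) ℝ) :=
  contDiff_pi.2 fun k => contDiff_pi.2 fun l =>
    (contDiff_apply_apply ℝ ℂ k l).norm_sq ℝ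

theorem fderiv_sqNormMatrix_apply {n : ℕ} (u A : Matrix (Fin n) (Fin n) ℂ) :
    fderiv ℝ sqNormMatrix u (A * u) = sqNormDeriv u A := by
  ext k l
  -- The entries of the derivative are computed along the affine line `u + t A u`.
  have hline : HasDerivAt (fun t : ℝ => u + t • (A * u)) (A * u) 0 := by
    have h := ((hasDerivAt_id (0 : ℝ)).smul_const (A * u)).const_add u
    rwa [one_smul] at h
  have hdiff : DifferentiableAt ℝ (sqNormMatrix (n := n)) u :=
    (contDiff_sqNormMatrix.differentiable (by simp)).differentiableAt
  have h1 := hdiff.hasFDerivAt.comp_hasDerivAt_of_eq (0 : ℝ) hline (by simp)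
  have h2 := hasDerivAt_pi.1 (hasDerivAt_pi.1 h1 k) l
  have h3 := (hasDerivAt_pi.1 (hasDerivAt_pi.1 hline k) l).norm_sq
  refine (h2.unique h3).trans ?_
  simp [sqNormDeriv_apply, Complex.inner]
  ring

theorem isSubmersionAt_of_det_regularityMap_ne_zero {n : ℕ} (u : Matrix.unitaryGroup (Fin n) ℂ)
    (hu : LinearMap.det (regularityMap (u : Matrix (Fin n) (Fin n) ℂ)) ≠ 0) :
    IsSubmersionAt (unitaryToUnitSum n) u := by
  refine ⟨sqNormMatrix, univ, isOpen_univ, mem_univ _, contDiff_sqNormMatrix.contDiffOn,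
    fun _ _ => rfl, fun v hv => ?_⟩
  obtain ⟨hr, hc⟩ := sums_eq_zero_of_mem_curveTangentSpace hv
  obtain ⟨A, hA, hAv⟩ := exists_sqNormDeriv_eq u.2 hu hr hc
  exact ⟨A * u, mul_mem_curveTangentSpace_unitaryGroup hA u.2,
    (fderiv_sqNormMatrix_apply _ A).trans hAv⟩

/-! ### Almost every point is regular -/

theorem secondCountableTopology_unitaryGroup (n : ℕ) :
    SecondCountableTopology (Matrix.unitaryGroup (Fin n) ℂ) :=
  have : SecondCountableTopology (Matrix (Fin n) (Fin n) ℂ) :=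
    inferInstanceAs (SecondCountableTopology (Fin n → Fin n → ℂ))
  TopologicalSpace.Subtype.secondCountableTopology _

theorem compactSpace_unitaryGroup (n : ℕ) : CompactSpace (Matrix.unitaryGroup (Fin n) ℂ) := by
  have hclosed : IsClosed (unitary (Matrix (Fin n) (Fin n) ℂ) : Set (Matrix (Fin n) (Fin n) ℂ)) :=
    isClosed_unitary
  have : ProperSpace (Matrix (Fin n) (Fin n) ℂ) := inferInstanceAs (ProperSpace (Fin n → Fin n → ℂ))
  refine isCompact_iff_compactSpace.1 (Metric.isCompact_of_isClosed_isBounded hclosed ?_)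
  refine (Metric.isBounded_closedBall (x := (0 : Matrix (Fin n) (Fin n) ℂ)) (r := 1)).subset ?_
  intro u hu
  rw [mem_closedBall_zero_iff]
  exact (Matrix.norm_le_iff zero_le_one).2 fun i j => entry_norm_bound_of_unitary hu i j

theorem mainTheorem1 (n : ℕ)
    [MeasurableSpace (Matrix.unitaryGroup (Fin n) ℂ)] [BorelSpace (Matrix.unitaryGroup (Fin n) ℂ)]
    (ν : Measure (Matrix.unitaryGroup (Fin n) ℂ)) [ν.IsHaarMeasure] :
    ∀ᵐ u ∂ν, IsSubmersionAt (unitaryToUnitSum n) u := by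
  have := secondCountableTopology_unitaryGroup n
  have := compactSpace_unitaryGroup n
  have hF : Continuous fun u : Matrix.unitaryGroup (Fin n) ℂ =>
      LinearMap.det (regularityMap (u : Matrix (Fin n) (Fin n) ℂ)) :=
    continuous_det_regularityMap.comp continuous_subtype_val
  have hreg : ∀ᵐ u : Matrix.unitaryGroup (Fin n) ℂ ∂ν,
      LinearMap.det (regularityMap (u : Matrix (Fin n) (Fin n) ℂ)) ≠ 0 := by
    refine ae_ne_zero_of_curves ν hF (g₀ := ⟨regularPoint n, regularPoint_mem_unitaryGroup n⟩)
      (by simp [regularityMap_regularPoint]) fun h => ?_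
    obtain ⟨z, K, hz, hK, hK1⟩ := exists_phase_cayleyCurve_one_eq h.2
    refine ⟨fun t => ⟨cayleyCurve K t, cayleyCurve_mem_unitaryGroup hK t⟩, ?_, ?_, ?_, ?_⟩
    · exact Continuous.subtype_mk (continuous_matrix fun i j => continuous_iff_continuousAt.2
        fun t => (analyticAt_cayleyCurve hK t i j).continuousAt) _
    · exact Subtype.ext (cayleyCurve_zero K)
    · intro g t _
      exact analyticAt_det_regularityMap (analyticAt_matrix_mul (analyticAt_cayleyCurve hK t)
        (N := fun _ => g) fun _ _ => analyticAt_const)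
    · intro g
      simp only [Submonoid.coe_mul]
      rw [hK1, smul_mul_assoc, regularityMap_smul hz]
  filter_upwards [hreg] with u hu
  exact isSubmersionAt_of_det_regularityMap_ne_zero u hu
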